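/- Let $I_1=\,]-1,1[$ and $\mathbb Z^\times=\mathbb Z\setminus\{0\}$. For a function $f$ on $I_1$ let $T_1$ denote the subtransfer operator \[ T_1f(x)=\sum_{m\in\mathbb Z^\times}\frac{1}{(2m+x)^2}\,f\!\left(-\frac{1}{2m+x}\right),\qquad x\in I_1, \] whenever the series converges absolutely. For $t,x\in I_1$ put \[ K_1(t,x)=\frac{t}{1+tx},\qquad K_1^{II}(t,x)=\frac{t^2x}{1-t^2x^2},\qquad k_1(t,x)=K_1(t,x)-T_1K_1(t,\cdot)(x), \] \[ k_1^{II}(t,x)=\tfrac12\bigl(k_1(t,-x)-k_1(t,x)\bigr). \] **Dynamic decomposition lemma.** For every fixed $t\in I_1$, the series defining $T_1K_1(t,\cdot)$ and all the iterates $T_1^jk_1^{II}(t,\cdot)$, $j\ge 0$, converge absolutely at every point of $I_1$; the functions $K_1^{II}(t,\cdot)$ and $T_1^jk_1^{II}(t,\cdot)$ belong to $L^1(I_1)$; and \[ K_1^{II}(t,x)=\sum_{j=0}^{+\infty}T_1^j k_1^{II}(t,\cdot)(x),\qquad x\in I_1, \] where the partial sums of the series converge at every point of $I_1$, uniformly on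 every compact subset of $I_1$, and in the norm of $L^1(I_1)$. -/

import Mathlib

open Filter Topology MeasureTheory

noncomputable section

namespace HilbertKernel

/-- The open interval `I₁ = ]-1, 1[`. -/
def I1 : Set ℝ := Set.Ioo (-1) 1

/-- The summand of index `m ∈ ℤ \ {0}` in the series that defines `T₁ f (x)`. -/
def transferTerm (f : ℝ → ℝ) (x : ℝ) (m : {m : ℤ // m ≠ 0}) : ℝ :=
  1 / (2 * ((m : ℤ) : ℝ) + x) ^ 2 * f (-1 / (2 * ((m : ℤ) : ℝ) + x))

/-- The subtransfer operator
`T₁ f (x) = ∑_{m ∈ ℤ \ {0}} (2 m + x)⁻² f (-1 / (2 m + x))`.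
For `x ∈ I₁` only the values of `f` on `I₁` enter. -/
def T1 (f : ℝ → ℝ) (x : ℝ) : ℝ := ∑' m : {m : ℤ // m ≠ 0}, transferTerm f x m

/-- The Hilbert kernel `K₁(t, x) = t / (1 + t x)`. -/
def K1 (t x : ℝ) : ℝ := t / (1 + t * x)

/-- The odd part `K₁^{II}(t, x) = t² x / (1 - t² x²)`; thus `K₁ = K₁^I - K₁^{II}`. -/
def K1II (t x : ℝ) : ℝ := t ^ 2 * x / (1 - t ^ 2 * x ^ 2)

/-- The dynamically reduced Hilbert kernel `k₁(t, ·) = (id - T₁) K₁(t, ·)`. -/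
def k1 (t x : ℝ) : ℝ := K1 t x - T1 (K1 t) x

/-- Its odd part `k₁^{II}(t, x) = (k₁(t, -x) - k₁(t, x)) / 2`; thus `k₁ = k₁^I - k₁^{II}`. -/
def k1II (t x : ℝ) : ℝ := (k1 t (-x) - k1 t x) / 2

/-- The partial sum `∑_{0 ≤ j < n} T₁^j k₁^{II}(t, ·)(x)`. -/
def partialSum (t : ℝ) (n : ℕ) (x : ℝ) : ℝ := ∑ j ∈ Finset.range n, (T1^[j] (k1II t)) x

end HilbertKernel

end

open HilbertKernel

/-! ### Branches of `T1` and formal properties of the operator -/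

namespace HilbertKernel

/-! Since `T1` commutes with reflection, `k1II` is `K1II - T1 K1II` on `I1`, so the partial sums
telescope to `K1II` minus its `n`-th iterate (`partialSum_eq`). It remains to send that iterate to
zero. `K1II` is odd, increasing and bounded, and `T1` preserves this. On such functions cancellation
leaves at most the term `m = -1` for `x ≥ 0` (`OddIncreasing.T1_le`). Its branch `x ↦ 1/(2 - x)` has
the neutral fixed point 1 and becomes translation by 1 in the coordinate `1/(1 - x)`. Hence a
constant bound `C` improves to `C / (1 + n(1 - x))²` (`DecayingOdd.T1`): locally uniform decay, and
`L¹` decay by domination by `C`. -/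

lemma neg_mem_I1 {x : ℝ} (hx : x ∈ I1) : -x ∈ I1 := by
  obtain ⟨h1, h2⟩ := hx
  constructor <;> linarith

/-- Shifting a point of `I₁` by a nonzero even integer leaves the closed unit interval. -/
lemma one_lt_abs_shift {x : ℝ} (hx : x ∈ I1) (m : {m : ℤ // m ≠ 0}) :
    1 < |2 * ((m : ℤ) : ℝ) + x| := by
  obtain ⟨h1, h2⟩ := hx
  rcases lt_or_gt_of_ne m.2 with h | h
  · have : ((m : ℤ) : ℝ) ≤ -1 := by exact_mod_cast (by omega : (m : ℤ) ≤ -1)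
    rw [lt_abs]; right; linarith
  · have : (1 : ℝ) ≤ ((m : ℤ) : ℝ) := by exact_mod_cast (by omega : 1 ≤ (m : ℤ))
    rw [lt_abs]; left; linarith

lemma branch_mem_I1 {x : ℝ} (hx : x ∈ I1) (m : {m : ℤ // m ≠ 0}) :
    -1 / (2 * ((m : ℤ) : ℝ) + x) ∈ I1 := by
  have h := one_lt_abs_shift hx m
  have : |-1 / (2 * ((m : ℤ) : ℝ) + x)| < 1 := by
    rw [abs_div, abs_neg, abs_one]
    exact (div_lt_one (by linarith)).2 h
  exact abs_lt.1 this

lemma abs_index_le_abs_shift {x : ℝ} (hx : x ∈ I1) (m : {m : ℤ // m ≠ 0}) :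
    |((m : ℤ) : ℝ)| ≤ |2 * ((m : ℤ) : ℝ) + x| := by
  obtain ⟨h1, h2⟩ := hx
  rcases lt_or_gt_of_ne m.2 with h | h
  · have : ((m : ℤ) : ℝ) ≤ -1 := by exact_mod_cast (by omega : (m : ℤ) ≤ -1)
    rw [abs_of_neg (by linarith), abs_of_neg (by linarith)]; linarith
  · have : (1 : ℝ) ≤ ((m : ℤ) : ℝ) := by exact_mod_cast (by omega : 1 ≤ (m : ℤ))
    rw [abs_of_pos (by linarith), abs_of_pos (by linarith)]; linarith

lemma summable_transferTerm {f : ℝ → ℝ} {B : ℝ} (hf : ∀ y ∈ I1, |f y| ≤ B) {x : ℝ}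
    (hx : x ∈ I1) : Summable (transferTerm f x) := by
  have hs : Summable (fun m : {m : ℤ // m ≠ 0} => 1 / ((m : ℤ) : ℝ) ^ 2 * B) :=
    (((Real.summable_one_div_int_pow (p := 2)).2 (by norm_num)).comp_injective
      Subtype.val_injective).mul_right B
  refine Summable.of_norm_bounded hs fun m => ?_
  have hm : (0 : ℝ) < |((m : ℤ) : ℝ)| := abs_pos.2 (by exact_mod_cast m.2)
  have hB : |f (-1 / (2 * ((m : ℤ) : ℝ) + x))| ≤ B := hf _ (branch_mem_I1 hx m)
  rw [transferTerm, Real.norm_eq_abs, abs_mul]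
  refine mul_le_mul ?_ hB (abs_nonneg _) (by positivity)
  rw [abs_of_nonneg (by positivity), ← sq_abs ((m : ℤ) : ℝ),
    ← sq_abs (2 * ((m : ℤ) : ℝ) + x)]
  exact one_div_le_one_div_of_le (by positivity)
    (pow_le_pow_left₀ hm.le (abs_index_le_abs_shift hx m) 2)

/-- Writing the summand of `T₁ f` in terms of `y ↦ y² f(y)` at the branch point. -/
lemma transferTerm_eq (f : ℝ → ℝ) (x : ℝ) (m : {m : ℤ // m ≠ 0}) :
    transferTerm f x m = (-1 / (2 * ((m : ℤ) : ℝ) + x)) ^ 2 * f (-1 / (2 * ((m : ℤ) : ℝ) + x)) := by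
  rw [transferTerm, div_pow]
  norm_num

lemma T1_congr {f g : ℝ → ℝ} (h : ∀ y ∈ I1, f y = g y) {x : ℝ} (hx : x ∈ I1) :
    T1 f x = T1 g x :=
  tsum_congr fun m => by rw [transferTerm, transferTerm, h _ (branch_mem_I1 hx m)]

/-- `T₁` commutes with the reflection `x ↦ -x`. -/
lemma T1_neg (f : ℝ → ℝ) (x : ℝ) : T1 f (-x) = T1 (fun y => f (-y)) x := by
  let e : {m : ℤ // m ≠ 0} ≃ {m : ℤ // m ≠ 0} :=
    (Equiv.neg ℤ).subtypeEquiv fun m => by simp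
  rw [T1, T1, ← e.tsum_eq]
  refine tsum_congr fun m => ?_
  have he : (((e m : {m : ℤ // m ≠ 0}) : ℤ) : ℝ) = -((m : ℤ) : ℝ) := by simp [e]
  rw [transferTerm, transferTerm, he,
    show 2 * -((m : ℤ) : ℝ) + -x = -(2 * ((m : ℤ) : ℝ) + x) by ring, neg_sq, div_neg]

lemma T1_sub {f g : ℝ → ℝ} {x : ℝ} (hf : Summable (transferTerm f x))
    (hg : Summable (transferTerm g x)) : T1 (fun y => f y - g y) x = T1 f x - T1 g x := by
  rw [T1, T1, T1, ← hf.tsum_sub hg]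
  exact tsum_congr fun m => by simp only [transferTerm]; ring

lemma T1_div_const (f : ℝ → ℝ) (c x : ℝ) : T1 (fun y => f y / c) x = T1 f x / c := by
  rw [T1, T1, ← tsum_div_const]
  exact tsum_congr fun m => by simp only [transferTerm]; ring

/-! ### Odd increasing functions under `T1` -/

/-- Odd increasing functions on `I₁`. -/
structure OddIncreasing (f : ℝ → ℝ) : Prop where
  odd : ∀ x ∈ I1, f (-x) = -f x
  mono : MonotoneOn f I1

namespace OddIncreasing

variable {f : ℝ → ℝ}

lemma zero (hf : OddIncreasing f) : f 0 = 0 := by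
  have := hf.odd 0 (by constructor <;> norm_num)
  rw [neg_zero] at this
  linarith

lemma nonneg (hf : OddIncreasing f) {x : ℝ} (h0 : 0 ≤ x) (h1 : x < 1) : 0 ≤ f x :=
  hf.zero ▸ hf.mono (by constructor <;> norm_num) ⟨by linarith, h1⟩ h0

lemma abs_eq (hf : OddIncreasing f) {x : ℝ} (hx : x ∈ I1) : |f x| = f |x| := by
  rcases le_total 0 x with h | h
  · rw [abs_of_nonneg h, abs_of_nonneg (hf.nonneg h hx.2)]
  · have h' := hf.nonneg (neg_nonneg.2 h) (neg_mem_I1 hx).2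
    rw [abs_of_nonpos h, ← abs_of_nonneg h', hf.odd x hx, abs_neg]

/-- The terms of `T1 f` are values of `y² f(y)` at branch points, so monotonicity of `T1 f` rests on
this function. -/
lemma sq_mul (hf : OddIncreasing f) : OddIncreasing fun y => y ^ 2 * f y := by
  have hodd : ∀ x ∈ I1, (-x) ^ 2 * f (-x) = -(x ^ 2 * f x) := fun x hx => by
    rw [hf.odd x hx]; ring
  have hpos : ∀ x y : ℝ, 0 ≤ x → x ≤ y → y < 1 → x ^ 2 * f x ≤ y ^ 2 * f y :=
    fun x y h0 h h1 => mul_le_mul (pow_le_pow_left₀ h0 h 2)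
      (hf.mono ⟨by linarith, by linarith⟩ ⟨by linarith, h1⟩ h)
      (hf.nonneg h0 (by linarith)) (by positivity)
  refine ⟨hodd, fun x hx y hy hxy => ?_⟩
  obtain ⟨hx1, hx2⟩ := id hx
  obtain ⟨hy1, hy2⟩ := id hy
  rcases le_total 0 x with h | h
  · exact hpos x y h hxy hy2
  · rcases le_total 0 y with h' | h'
    · have h3 := hpos 0 (-x) le_rfl (by linarith) (by linarith)
      have h4 := hpos 0 y le_rfl h' hy2
      rw [hodd x hx] at h3
      linarith
    · have h3 := hpos (-y) (-x) (by linarith) (by linarith) (by linarith)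
      rw [hodd x hx, hodd y hy] at h3
      linarith

lemma T1 (hf : OddIncreasing f) {B : ℝ} (hB : ∀ y ∈ I1, |f y| ≤ B) :
    OddIncreasing (HilbertKernel.T1 f) := by
  constructor
  · intro x hx
    rw [T1_neg, T1_congr hf.odd hx, HilbertKernel.T1, HilbertKernel.T1, ← tsum_neg]
    exact tsum_congr fun m => by simp only [transferTerm]; ring
  · intro x hx y hy hxy
    refine (summable_transferTerm hB hx).tsum_le_tsum (fun m => ?_) (summable_transferTerm hB hy)
    rw [transferTerm_eq, transferTerm_eq]
    refine hf.sq_mul.mono (branch_mem_I1 hx m) (branch_mem_I1 hy m) ?_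
    obtain ⟨hx1, hx2⟩ := hx
    obtain ⟨hy1, hy2⟩ := hy
    -- Every branch is increasing, because `2m + x` keeps its sign on `I1`.
    rw [neg_div, neg_div, neg_le_neg_iff]
    rcases lt_or_gt_of_ne m.2 with h | h
    · have : ((m : ℤ) : ℝ) ≤ -1 := by exact_mod_cast (by omega : (m : ℤ) ≤ -1)
      exact one_div_le_one_div_of_neg_of_le (by linarith) (by linarith)
    · have : (1 : ℝ) ≤ ((m : ℤ) : ℝ) := by exact_mod_cast (by omega : 1 ≤ (m : ℤ))
      exact one_div_le_one_div_of_le (by linarith) (by linarith)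

/-- The series of `T₁ f` is dominated by its leading term: the remaining ones alternate in sign and
decrease in size. -/
lemma T1_le (hf : OddIncreasing f) {B : ℝ} (hB : ∀ y ∈ I1, |f y| ≤ B) {x : ℝ}
    (h0 : 0 ≤ x) (h1 : x < 1) :
    HilbertKernel.T1 f x ≤ (1 / (2 - x)) ^ 2 * f (1 / (2 - x)) := by
  have hx : x ∈ I1 := ⟨by linarith, h1⟩
  have hs := summable_transferTerm hB hx
  have hg := hf.sq_mul
  set g : ℝ → ℝ := fun y => y ^ 2 * f y with hgdef
  let u : ℤ → ℝ := fun m => g (-1 / (2 * (m : ℝ) + x))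
  have hterm : transferTerm f x = fun m : {m : ℤ // m ≠ 0} => u m :=
    funext fun m => transferTerm_eq f x m
  let U : ℤ → ℝ := ({m : ℤ | m ≠ 0}).indicator u
  have hU : Summable U := by
    rw [hterm] at hs
    exact summable_subtype_iff_indicator.1 hs
  have hTU : HilbertKernel.T1 f x = ∑' m, U m := by
    rw [HilbertKernel.T1, hterm]
    exact tsum_subtype {m : ℤ | m ≠ 0} u
  have hbr : ∀ c : ℝ, 1 < c → 1 / c ∈ I1 := fun c hc =>
    ⟨lt_trans (by norm_num) (by positivity : (0 : ℝ) < 1 / c),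
      (div_lt_one (by linarith)).2 hc⟩
  have hv : ∀ k : ℕ, U (-((k : ℤ) + 1)) = g (1 / (2 * (k + 1) - x)) := fun k => by
    have : (-((k : ℤ) + 1)) ∈ {m : ℤ | m ≠ 0} := by
      simp only [Set.mem_ofPred_eq]; omega
    simp only [U, Set.indicator_of_mem this, u]
    push_cast
    rw [← neg_div_neg_eq]
    congr 2 <;> ring
  have hw : ∀ k : ℕ, U ((k : ℤ) + 1) = -g (1 / (2 * (k + 1) + x)) := fun k => by
    have : ((k : ℤ) + 1) ∈ {m : ℤ | m ≠ 0} := by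
      simp only [Set.mem_ofPred_eq]; omega
    have hk : (0 : ℝ) ≤ k := k.cast_nonneg
    simp only [U, Set.indicator_of_mem this, u]
    push_cast
    rw [neg_div]
    exact hg.odd _ (hbr _ (by linarith))
  have hU0 : U 0 = 0 := by simp [U]
  have hp : Summable fun n : ℕ => U n := hU.comp_injective Nat.cast_injective
  have hn : Summable fun n : ℕ => U (-((n : ℤ) + 1)) :=
    hU.comp_injective fun a b h => by simpa using h
  have hp' : Summable fun n : ℕ => U ((n : ℤ) + 1) := by
    simpa using (summable_nat_add_iff 1).2 hp
  have hn' : Summable fun n : ℕ => U (-(((n + 1 : ℕ) : ℤ) + 1)) := (summable_nat_add_iff 1).2 hn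
  -- Index `n + 1` is paired with `-(n + 2)`, leaving `-1` alone. Each pair is nonpositive because
  -- `2(n + 2) - x ≥ 2(n + 1) + x` for `x ≤ 1`.
  have hsplit : ∑' m, U m = U (-1) +
      ∑' n : ℕ, (U ((n : ℤ) + 1) + U (-(((n + 1 : ℕ) : ℤ) + 1))) := by
    rw [tsum_of_nat_of_neg_add_one hp hn, hp.tsum_eq_zero_add, hn.tsum_eq_zero_add,
      hp'.tsum_add hn']
    simp only [Nat.cast_zero, hU0, zero_add, Nat.cast_add, Nat.cast_one]
    ring
  have hneg : ∑' n : ℕ, (U ((n : ℤ) + 1) + U (-(((n + 1 : ℕ) : ℤ) + 1))) ≤ 0 := by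
    refine tsum_nonpos fun k => ?_
    have hk : (0 : ℝ) ≤ k := k.cast_nonneg
    rw [hv, hw]
    push_cast
    have := hg.mono (hbr (2 * ((k : ℝ) + 1 + 1) - x) (by linarith))
      (hbr (2 * ((k : ℝ) + 1) + x) (by linarith))
      (one_div_le_one_div_of_le (by linarith) (by linarith))
    linarith
  have h_lead : U (-1) = g (1 / (2 - x)) := by simpa using hv 0
  rw [hTU, hsplit, h_lead]
  simp only [hgdef] at hneg ⊢
  linarith

end OddIncreasing

/-! ### Quadratic decay along iterates -/

/-- Odd increasing functions with the decay `C (1 + n (1 - x))⁻²` of `n`-fold `T₁`-images. -/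
structure DecayingOdd (C : ℝ) (n : ℕ) (f : ℝ → ℝ) : Prop extends OddIncreasing f where
  le : ∀ x, 0 ≤ x → x < 1 → f x ≤ C / (1 + n * (1 - x)) ^ 2

namespace DecayingOdd

variable {C : ℝ} {n : ℕ} {f : ℝ → ℝ}

lemma abs_le (hf : DecayingOdd C n f) {x : ℝ} (hx : x ∈ I1) :
    |f x| ≤ C / (1 + n * (1 - |x|)) ^ 2 :=
  hf.abs_eq hx ▸ hf.le _ (abs_nonneg x) (abs_lt.2 hx)

lemma const_nonneg (hf : DecayingOdd C n f) : 0 ≤ C := by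
  have h := hf.le 0 le_rfl one_pos
  rw [hf.zero] at h
  by_contra! hC
  exact absurd h (not_le.2 (div_neg_of_neg_of_pos hC (by positivity)))

lemma abs_le_const (hf : DecayingOdd C n f) {x : ℝ} (hx : x ∈ I1) : |f x| ≤ C := by
  have h : 0 ≤ 1 - |x| := sub_nonneg.2 (abs_lt.2 hx).le
  have hn : (0 : ℝ) ≤ n * (1 - |x|) := by positivity
  exact (hf.abs_le hx).trans (div_le_self hf.const_nonneg (one_le_pow₀ (by linarith)))

lemma T1 (hf : DecayingOdd C n f) : DecayingOdd C (n + 1) (HilbertKernel.T1 f) where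
  toOddIncreasing := hf.toOddIncreasing.T1 fun _ => hf.abs_le_const
  le x h0 h1 := by
    have hpos : 0 < 2 - x := by linarith
    refine (hf.T1_le (fun _ => hf.abs_le_const) h0 h1).trans ?_
    have h := hf.le (1 / (2 - x)) (by positivity) ((div_lt_one hpos).2 (by linarith))
    refine (mul_le_mul_of_nonneg_left h (by positivity)).trans_eq ?_
    -- The denominator `2 - x` produced here cancels, once squared, the weight `(1/(2 - x))²`, so
    -- `C` is unchanged.
    have hd : 1 + (n : ℝ) * (1 - 1 / (2 - x)) =
        (1 + ((n + 1 : ℕ) : ℝ) * (1 - x)) / (2 - x) := by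
      push_cast
      field_simp
      ring
    have h2 : (0 : ℝ) < 1 + ((n + 1 : ℕ) : ℝ) * (1 - x) := by
      have : 0 < 1 - x := by linarith
      positivity
    rw [hd]
    field_simp

end DecayingOdd

/-! ### The Hilbert kernel and telescoping -/

lemma one_sub_abs_le {t x : ℝ} (hx : x ∈ I1) : 1 - |t| ≤ 1 + t * x := by
  have h1 := neg_abs_le (t * x)
  rw [abs_mul] at h1
  have h2 : |t| * |x| ≤ |t| := mul_le_of_le_one_right (abs_nonneg t) (abs_lt.2 hx).le
  linarith

lemma abs_K1_le {t : ℝ} (ht : t ∈ I1) {x : ℝ} (hx : x ∈ I1) : |K1 t x| ≤ |t| / (1 - |t|) := by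
  have h := one_sub_abs_le (t := t) hx
  have h0 : 0 < 1 - |t| := sub_pos.2 (abs_lt.2 ht)
  rw [K1, abs_div, abs_of_pos (h0.trans_le h)]
  gcongr

lemma K1II_eq {t : ℝ} (ht : t ∈ I1) {x : ℝ} (hx : x ∈ I1) :
    K1II t x = (K1 t (-x) - K1 t x) / 2 := by
  have h0 : 0 < 1 - |t| := sub_pos.2 (abs_lt.2 ht)
  have h1 := (h0.trans_le (one_sub_abs_le (t := t) hx)).ne'
  have h2 := (h0.trans_le (one_sub_abs_le (t := t) (neg_mem_I1 hx))).ne'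
  have h3 : 1 - t ^ 2 * x ^ 2 = (1 + t * x) * (1 + t * -x) := by ring
  rw [K1II, K1, K1, h3]
  rw [mul_neg, ← sub_eq_add_neg] at h2 ⊢
  field_simp
  ring

lemma one_sub_sq_mul_sq_pos {t : ℝ} (ht : t ∈ I1) {x : ℝ} (hx : x ∈ I1) :
    0 < 1 - t ^ 2 * x ^ 2 := by
  have h0 : 0 < 1 - |t| := sub_pos.2 (abs_lt.2 ht)
  have h1 := h0.trans_le (one_sub_abs_le (t := t) hx)
  have h2 := h0.trans_le (one_sub_abs_le (t := t) (neg_mem_I1 hx))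
  have h3 : 1 - t ^ 2 * x ^ 2 = (1 + t * x) * (1 + t * -x) := by ring
  rw [h3]
  positivity

lemma decayingOdd_K1II {t : ℝ} (ht : t ∈ I1) :
    DecayingOdd (t ^ 2 / (1 - t ^ 2)) 0 (K1II t) where
  odd x _ := by
    simp only [K1II]
    ring
  mono x hx y hy hxy := by
    have hX := one_sub_sq_mul_sq_pos ht hx
    have hY := one_sub_sq_mul_sq_pos ht hy
    have hxy' : 0 ≤ 1 + t ^ 2 * (x * y) := by
      have h1 : |t ^ 2 * (x * y)| ≤ 1 := by
        rw [abs_mul, abs_mul, abs_pow]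
        exact mul_le_one₀ (pow_le_one₀ (abs_nonneg _) (abs_lt.2 ht).le) (by positivity)
          (mul_le_one₀ (abs_lt.2 hx).le (abs_nonneg _) (abs_lt.2 hy).le)
      linarith [neg_abs_le (t ^ 2 * (x * y))]
    rw [K1II, K1II, div_le_div_iff₀ hX hY]
    -- This is the difference of the two sides after cross-multiplication.
    have : 0 ≤ t ^ 2 * ((y - x) * (1 + t ^ 2 * (x * y))) :=
      mul_nonneg (sq_nonneg t) (mul_nonneg (sub_nonneg.2 hxy) hxy')
    linarith
  le x h0 h1 := by
    have ht2 : 0 < 1 - t ^ 2 := sub_pos.2 ((sq_lt_one_iff_abs_lt_one t).2 (abs_lt.2 ht))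
    have hx2 : x ^ 2 ≤ 1 := pow_le_one₀ h0 h1.le
    rw [Nat.cast_zero, zero_mul, add_zero, one_pow, div_one, K1II]
    refine div_le_div₀ (sq_nonneg t) (mul_le_of_le_one_right (sq_nonneg t) h1.le) ht2 ?_
    have := mul_le_of_le_one_right (sq_nonneg t) hx2
    linarith

lemma decayingOdd_iterate_K1II {t : ℝ} (ht : t ∈ I1) (n : ℕ) :
    DecayingOdd (t ^ 2 / (1 - t ^ 2)) n (T1^[n] (K1II t)) := by
  induction n with
  | zero => exact decayingOdd_K1II ht
  | succ n ih =>
    rw [Function.iterate_succ_apply']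
    exact ih.T1

/-- `k₁^{II} = (id - T₁) K₁^{II}` on `I₁`. -/
lemma k1II_eq {t : ℝ} (ht : t ∈ I1) {x : ℝ} (hx : x ∈ I1) :
    k1II t x = K1II t x - T1 (K1II t) x := by
  have h1 : Summable (transferTerm (K1 t) x) :=
    summable_transferTerm (fun _ => abs_K1_le ht) hx
  have h2 : Summable (transferTerm (fun y => K1 t (-y)) x) :=
    summable_transferTerm (fun _ hy => abs_K1_le ht (neg_mem_I1 hy)) hx
  rw [T1_congr (fun _ => K1II_eq ht) hx, T1_div_const, T1_sub h2 h1, ← T1_neg, K1II_eq ht hx,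
    k1II, k1, k1]
  ring

/-- The induction runs over all of `I1` at once, since `T1` evaluates its argument at every branch
point. -/
lemma iterate_k1II_eq {t : ℝ} (ht : t ∈ I1) (j : ℕ) : ∀ x ∈ I1,
    (T1^[j] (k1II t)) x = (T1^[j] (K1II t)) x - (T1^[j + 1] (K1II t)) x := by
  induction j with
  | zero => exact fun x hx => k1II_eq ht hx
  | succ j ih =>
    intro x hx
    rw [Function.iterate_succ_apply', T1_congr ih hx, T1_sub, ← Function.iterate_succ_apply' T1,
      ← Function.iterate_succ_apply' T1]
    · exact summable_transferTerm (fun _ => (decayingOdd_iterate_K1II ht j).abs_le_const) hx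
    · exact summable_transferTerm (fun _ => (decayingOdd_iterate_K1II ht (j + 1)).abs_le_const) hx

lemma partialSum_eq {t : ℝ} (ht : t ∈ I1) (n : ℕ) {x : ℝ} (hx : x ∈ I1) :
    partialSum t n x = K1II t x - (T1^[n] (K1II t)) x := by
  rw [partialSum, Finset.sum_congr rfl fun j _ => iterate_k1II_eq ht j x hx,
    Finset.sum_range_sub' fun j => (T1^[j] (K1II t)) x]
  rfl

/-! ### Locally uniform and `L¹` convergence -/

lemma tendsto_decay (C : ℝ) {r : ℝ} (hr : r < 1) :
    Tendsto (fun n : ℕ => C / (1 + (n : ℝ) * (1 - r)) ^ 2) atTop (𝓝 0) := by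
  have h : Tendsto (fun n : ℕ => 1 + (n : ℝ) * (1 - r)) atTop atTop :=
    tendsto_atTop_add_const_left _ _
      (tendsto_natCast_atTop_atTop.atTop_mul_const (sub_pos.2 hr))
  exact ((tendsto_pow_atTop two_ne_zero).comp h).const_div_atTop C

lemma tendstoUniformlyOn_partialSum {t : ℝ} (ht : t ∈ I1) {r : ℝ} (hr : r < 1) :
    TendstoUniformlyOn (partialSum t) (K1II t) atTop {x | |x| ≤ r} := by
  rw [Metric.tendstoUniformlyOn_iff]
  intro ε hε
  filter_upwards [(tendsto_decay (t ^ 2 / (1 - t ^ 2)) hr).eventually_lt_const hε] with n hn x hx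
  have hxr : |x| ≤ r := hx
  have hxI : x ∈ I1 := abs_lt.1 (hxr.trans_lt hr)
  have hF := decayingOdd_iterate_K1II ht n
  rw [partialSum_eq ht n hxI, Real.dist_eq, sub_sub_cancel]
  refine ((hF.abs_le hxI).trans ?_).trans_lt hn
  have h1 : 0 < 1 - r := sub_pos.2 hr
  exact div_le_div_of_nonneg_left hF.const_nonneg (by positivity)
    (pow_le_pow_left₀ (by positivity) (by gcongr) 2)

lemma DecayingOdd.integrableOn {C : ℝ} {n : ℕ} {f : ℝ → ℝ} (hf : DecayingOdd C n f) :
    IntegrableOn f I1 volume := by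
  have hm : AEMeasurable f (volume.restrict I1) :=
    aemeasurable_restrict_of_monotoneOn measurableSet_Ioo hf.mono
  have : IsFiniteMeasure (volume.restrict I1) := ⟨by simp [I1]⟩
  refine Integrable.of_bound hm.aestronglyMeasurable C ?_
  exact (ae_restrict_mem measurableSet_Ioo).mono fun x hx => hf.abs_le_const hx

lemma tendsto_eLpNorm_iterate_K1II {t : ℝ} (ht : t ∈ I1) :
    Tendsto (fun n : ℕ => eLpNorm (T1^[n] (K1II t)) 1 (volume.restrict I1)) atTop (𝓝 0) := by
  simp only [eLpNorm_one_eq_lintegral_enorm]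
  have h := tendsto_lintegral_of_dominated_convergence' (μ := volume.restrict I1)
    (F := fun n x => ‖(T1^[n] (K1II t)) x‖ₑ) (f := fun _ => 0)
    (fun _ => ENNReal.ofReal (t ^ 2 / (1 - t ^ 2)))
    (fun n => (decayingOdd_iterate_K1II ht n).integrableOn.aestronglyMeasurable.enorm)
    (fun n => (ae_restrict_mem measurableSet_Ioo).mono fun x hx => by
      dsimp only
      rw [← ofReal_norm]
      exact ENNReal.ofReal_le_ofReal ((decayingOdd_iterate_K1II ht n).abs_le_const hx))
    (by simp [I1, ENNReal.mul_eq_top])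
    ((ae_restrict_mem measurableSet_Ioo).mono fun x hx => by
      have h0 : Tendsto (fun n : ℕ => (T1^[n] (K1II t)) x) atTop (𝓝 0) :=
        squeeze_zero_norm (fun n => (decayingOdd_iterate_K1II ht n).abs_le hx)
          (tendsto_decay _ (abs_lt.2 hx))
      simpa using h0.enorm)
  simpa using h

end HilbertKernel

open HilbertKernel
theorem mainTheorem11 (t : ℝ) (ht : t ∈ I1) :
    -- the series defining `T₁ K₁(t, ·)` and all iterates `T₁^j k₁^{II}(t, ·)` converge on `I₁`
    (∀ x ∈ I1, Summable (transferTerm (K1 t) x)) ∧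
    (∀ j : ℕ, ∀ x ∈ I1, Summable (transferTerm (T1^[j] (k1II t)) x)) ∧
    -- the decomposition holds at every point of `I₁`
    (∀ x ∈ I1, Tendsto (fun n : ℕ => partialSum t n x) atTop (𝓝 (K1II t x))) ∧
    -- uniform convergence on compact subsets of `I₁`
    (∀ C : Set ℝ, IsCompact C → C ⊆ I1 →
      TendstoUniformlyOn (partialSum t) (K1II t) atTop C) ∧
    -- norm convergence in `L¹(I₁)`
    IntegrableOn (K1II t) I1 volume ∧
    (∀ j : ℕ, IntegrableOn (T1^[j] (k1II t)) I1 volume) ∧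
    Tendsto (fun n : ℕ => eLpNorm (fun x => partialSum t n x - K1II t x) 1 (volume.restrict I1))
      atTop (𝓝 0) := by
  refine ⟨fun x hx => summable_transferTerm (fun _ => abs_K1_le ht) hx, fun j x hx => ?_,
    fun x hx => ?_, fun C hC hCI => ?_, (decayingOdd_K1II ht).integrableOn, fun j => ?_, ?_⟩
  · refine summable_transferTerm (B := t ^ 2 / (1 - t ^ 2) + t ^ 2 / (1 - t ^ 2)) (fun y hy => ?_) hx
    rw [iterate_k1II_eq ht j y hy]
    exact (abs_sub _ _).trans (add_le_add ((decayingOdd_iterate_K1II ht j).abs_le_const hy)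
      ((decayingOdd_iterate_K1II ht (j + 1)).abs_le_const hy))
  · exact (tendstoUniformlyOn_partialSum ht (abs_lt.2 hx)).tendsto_at (Set.mem_ofPred.2 le_rfl)
  · rcases C.eq_empty_or_nonempty with rfl | hne
    · exact tendstoUniformlyOn_empty
    -- The maximum of `|x|` on `C` is attained, hence below 1, and serves as the radius `r`.
    · obtain ⟨z, hz, hmax⟩ := hC.exists_isMaxOn hne continuous_abs.continuousOn
      exact (tendstoUniformlyOn_partialSum ht (abs_lt.2 (hCI hz))).mono fun x hx => hmax hx
  · exact ((decayingOdd_iterate_K1II ht j).integrableOn.sub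
      (decayingOdd_iterate_K1II ht (j + 1)).integrableOn).congr_fun
        (fun x hx => (iterate_k1II_eq ht j x hx).symm) measurableSet_Ioo
  · refine (tendsto_eLpNorm_iterate_K1II ht).congr fun n => ?_
    rw [← eLpNorm_neg]
    refine eLpNorm_congr_ae ((ae_restrict_mem measurableSet_Ioo).mono fun x hx => ?_)
    simp only [Pi.neg_apply, partialSum_eq ht n hx]
    ring
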